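/- All polynomials, sequences and arrays are binary (over $\mathbb{F}_2$). The exponent of a polynomial $h$ is the least positive integer $e$ such that $h(x)$ divides $x^e-1$. A polynomial $c(x)=1-\sum_{i=1}^{n}c_ix^i$ of degree $n$ generates the sequences $(a_k)_{k\ge 0}$ with $a_k=\sum_{i=1}^n c_ia_{k-i}$ for all $k\ge n$. For polynomials $f,g$ let $f\vee g=\prod_{\alpha}\prod_{\beta}(x-\alpha\beta)$, where $\alpha$ and $\beta$ run through the roots of $f$ and of $g$, respectively, in an algebraic closure of $\mathbb{F}_2$; it has coefficients in $\mathbb{F}_2$. Let $\gcd(r_1,r_2)=1$. Arrays of size $r_1\times r_2$ are doubly periodic and are identified if they are cyclic shifts (vertical and horizontal) of each other. Folding a sequence of period $r_1r_2$ means writing $a_k$, $0\le k<r_1r_2$, at position $(k \bmod r_1,\,k\bmod r_2)$ of an $r_1\times r_2$ array. An $(r_1,r_2;m_1,m_2)$-PRAC (pseudo-random array code) is a set $\mathbb{C}$ of such arrays such that (i) $r_1r_2$ divides $2^{m_1m_2}-1$; (ii) each nonzero $m_1\times m_2$ matrix appears exactly once as a window in the arrays of $\mathbb{C}$, and the all-zero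 $m_1\times m_2$ matrix does not appear; (iii) if $A,B$ are (shifts of) codewords which either represent distinct codewords or are such that $B$ is a nontrivial shift of $A$, then $A+B$ is (a shift of) a codeword. **Lemma.** Let $\ell\ge 2$, let $f_1$ be an irreducible polynomial of degree $n_1$ and exponent $r_1$, and let $h_1,\dots,h_\ell$ be distinct irreducible polynomials of degree $n_2$ and exponent $r_2$, where $\gcd(r_1,r_2)=1$. Then all nonzero sequences generated by $f_1\vee\prod_{i=1}^{\ell}h_i$, and all nonzero sequences generated by $f_1\vee\prod_{i=1}^{\ell-1}h_i$, have least period $r_1r_2$. Folding the former into $r_1\times r_2$ arrays yields an $(r_1,r_2;n_1,\ell n_2)$-PRAC, folding the latter yields an $(r_1,r_2;n_1,(\ell-1)n_2)$-PRAC, and every array of the latter code is an array of the former. -/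

import Mathlib

open Polynomial

namespace ArrayCode

noncomputable section

/-! ### Polynomials over the binary field and the sequences they generate -/

/-- The exponent of `h` is `e`: the least positive `e` such that `h` divides `X ^ e - 1`.
(There is such an `e` only if `h(0) ≠ 0`.) -/
def HasExponent (h : (ZMod 2)[X]) (e : ℕ) : Prop :=
  IsLeast {e : ℕ | 0 < e ∧ h ∣ X ^ e - 1} e

/-- The binary sequence `a` is generated by the characteristic polynomial
`c(x) = 1 - ∑_{i=1}^n c_i x^i` of degree `n`, that is, `a_k = ∑_{i=1}^n c_i a_{k-i}` for all
`k ≥ n` (the initial state `a_0, …, a_{n-1}` is arbitrary). -/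
def Generates (c : (ZMod 2)[X]) (a : ℕ → ZMod 2) : Prop :=
  ∀ k, c.natDegree ≤ k → a k = ∑ i ∈ Finset.Icc 1 c.natDegree, -c.coeff i * a (k - i)

/-- `p` is the least period of the sequence `a`. -/
def HasLeastPeriod (a : ℕ → ZMod 2) (p : ℕ) : Prop :=
  IsLeast {p : ℕ | 0 < p ∧ ∀ k, a (k + p) = a k} p

/-- `∏ (X - α β)` over an algebraic closure, where `α` runs through the roots of `f` and `β`
through the roots of `g`. -/
def rootProduct (f g : (ZMod 2)[X]) : (AlgebraicClosure (ZMod 2))[X] :=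
  ((f.aroots (AlgebraicClosure (ZMod 2))).map fun α =>
    ((g.aroots (AlgebraicClosure (ZMod 2))).map fun β => X - C (α * β)).prod).prod

theorem aroots_map_frobenius (f : (ZMod 2)[X]) :
    (f.aroots (AlgebraicClosure (ZMod 2))).map (frobenius (AlgebraicClosure (ZMod 2)) 2) =
      f.aroots (AlgebraicClosure (ZMod 2)) := by
  have h := (IsAlgClosed.splits (f.map (algebraMap (ZMod 2) (AlgebraicClosure (ZMod 2))))).roots_map
    (frobenius (AlgebraicClosure (ZMod 2)) 2)
  rw [Polynomial.map_map, Subsingleton.elim ((frobenius (AlgebraicClosure (ZMod 2)) 2).comp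
    (algebraMap (ZMod 2) (AlgebraicClosure (ZMod 2)))) (algebraMap _ _)] at h
  exact h.symm

/-- The product `∏ (X - α β)` has coefficients in the binary field. -/
theorem exists_map_eq_rootProduct (f g : (ZMod 2)[X]) :
    ∃ p : (ZMod 2)[X], p.map (algebraMap (ZMod 2) (AlgebraicClosure (ZMod 2))) =
      rootProduct f g := by
  have hfix : (rootProduct f g).map (frobenius (AlgebraicClosure (ZMod 2)) 2) =
      rootProduct f g := by
    have key : ∀ φ : AlgebraicClosure (ZMod 2) →+* AlgebraicClosure (ZMod 2),
        (rootProduct f g).map φ =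
          (((f.aroots (AlgebraicClosure (ZMod 2))).map φ).map fun α =>
            (((g.aroots (AlgebraicClosure (ZMod 2))).map φ).map
              fun β => X - C (α * β)).prod).prod := by
      intro φ
      simp [rootProduct, Polynomial.map_multiset_prod, Multiset.map_map]
    rw [key, aroots_map_frobenius, aroots_map_frobenius]
    rfl
  rw [← Polynomial.mem_lifts, Polynomial.lifts_iff_coeff_lifts]
  intro n
  have hn : (rootProduct f g).coeff n ^ 2 = (rootProduct f g).coeff n := by
    conv_rhs => rw [← hfix]
    rw [Polynomial.coeff_map, frobenius_def]
  have h01 : (rootProduct f g).coeff n = 0 ∨ (rootProduct f g).coeff n = 1 := by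
    have : (rootProduct f g).coeff n * ((rootProduct f g).coeff n - 1) = 0 := by
      rw [mul_sub, ← sq, hn, mul_one, sub_self]
    rcases mul_eq_zero.1 this with h | h
    · exact Or.inl h
    · exact Or.inr (sub_eq_zero.1 h)
  rcases h01 with h | h
  · exact ⟨0, by rw [h, map_zero]⟩
  · exact ⟨1, by rw [h, map_one]⟩

/-- `f ∨ g`: the binary polynomial whose roots are the products `α β` of a root `α` of `f` and a
root `β` of `g`. -/
def vee (f g : (ZMod 2)[X]) : (ZMod 2)[X] :=
  (exists_map_eq_rootProduct f g).choose

theorem map_vee (f g : (ZMod 2)[X]) :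
    (vee f g).map (algebraMap (ZMod 2) (AlgebraicClosure (ZMod 2))) = rootProduct f g :=
  (exists_map_eq_rootProduct f g).choose_spec

/-! ### Doubly periodic arrays and array codes -/

/-- A doubly periodic binary `r₁ × r₂` array. -/
abbrev TorusArray (r₁ r₂ : ℕ) : Type := Matrix (ZMod r₁) (ZMod r₂) (ZMod 2)

/-- The cyclic shift of an array by `v.1` vertically and by `v.2` horizontally. -/
def shift {r₁ r₂ : ℕ} (v : ZMod r₁ × ZMod r₂) (A : TorusArray r₁ r₂) : TorusArray r₁ r₂ :=
  fun i j => A (i + v.1) (j + v.2)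

/-- Arrays are identified if they are cyclic shifts of each other. -/
def shiftSetoid (r₁ r₂ : ℕ) : Setoid (TorusArray r₁ r₂) where
  r A B := ∃ v, B = shift v A
  iseqv :=
    { refl := fun A => ⟨0, by ext i j; simp [shift]⟩
      symm := by
        rintro A B ⟨v, rfl⟩
        exact ⟨-v, by ext i j; simp [shift]⟩
      trans := by
        rintro A B D ⟨v, rfl⟩ ⟨w, rfl⟩
        exact ⟨w + v, by ext i j; simp [shift, add_assoc]⟩ }

/-- A codeword: a doubly periodic array up to cyclic shifts. -/
def CyclicArray (r₁ r₂ : ℕ) : Type := Quotient (shiftSetoid r₁ r₂)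

/-- The codeword represented by an array. -/
def toCyclic {r₁ r₂ : ℕ} (A : TorusArray r₁ r₂) : CyclicArray r₁ r₂ :=
  Quotient.mk (shiftSetoid r₁ r₂) A

/-- The `m₁ × m₂` window of `A` whose upper-left corner is at position `p`. -/
def window {r₁ r₂ : ℕ} (m₁ m₂ : ℕ) (A : TorusArray r₁ r₂) (p : ZMod r₁ × ZMod r₂) :
    Matrix (Fin m₁) (Fin m₂) (ZMod 2) :=
  fun s t => A (p.1 + (s : ℕ)) (p.2 + (t : ℕ))

theorem window_shift {r₁ r₂ m₁ m₂ : ℕ} (A : TorusArray r₁ r₂) (v p : ZMod r₁ × ZMod r₂) :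
    window m₁ m₂ (shift v A) p = window m₁ m₂ A (p + v) := by
  ext s t
  simp only [window, shift, Prod.fst_add, Prod.snd_add]
  rw [add_right_comm, add_right_comm p.2]

/-- The number of positions at which the matrix `M` appears as a window in a codeword. -/
def windowCount {r₁ r₂ m₁ m₂ : ℕ} (c : CyclicArray r₁ r₂)
    (M : Matrix (Fin m₁) (Fin m₂) (ZMod 2)) : ℕ∞ :=
  Quotient.lift (s := shiftSetoid r₁ r₂)
    (fun A : TorusArray r₁ r₂ => {p | window m₁ m₂ A p = M}.encard)
    (by
      rintro A B ⟨v, rfl⟩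
      have h : {p | window m₁ m₂ (shift v A) p = M} =
          (Equiv.addRight v) ⁻¹' {p | window m₁ m₂ A p = M} := by
        ext p
        simp [window_shift]
      change _ = Set.encard {p | window m₁ m₂ (shift v A) p = M}
      rw [h, Set.encard_preimage_of_bijective (Equiv.addRight v).bijective]) c

/-- An `(r₁, r₂; m₁, m₂)` shortened de Bruijn array code: `r₁ r₂` divides `2 ^ (m₁ m₂) - 1`, each
nonzero `m₁ × m₂` matrix appears exactly once as a window in the codewords, and the all-zero
`m₁ × m₂` matrix does not appear. -/
structure IsSDBAC {r₁ r₂ : ℕ} (m₁ m₂ : ℕ) (𝒞 : Set (CyclicArray r₁ r₂)) : Prop where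
  dvd : r₁ * r₂ ∣ 2 ^ (m₁ * m₂) - 1
  window_once : ∀ M : Matrix (Fin m₁) (Fin m₂) (ZMod 2), M ≠ 0 →
    ∃ c ∈ 𝒞, windowCount c M = 1 ∧ ∀ d ∈ 𝒞, d ≠ c → windowCount d M = 0
  window_zero : ∀ c ∈ 𝒞, windowCount c (0 : Matrix (Fin m₁) (Fin m₂) (ZMod 2)) = 0

/-- An `(r₁, r₂; m₁, m₂)` pseudo-random array code: a shortened de Bruijn array code with the
shift-and-add property. -/
structure IsPRAC {r₁ r₂ : ℕ} (m₁ m₂ : ℕ) (𝒞 : Set (CyclicArray r₁ r₂)) : Prop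
    extends IsSDBAC m₁ m₂ 𝒞 where
  shift_and_add : ∀ A B : TorusArray r₁ r₂, toCyclic A ∈ 𝒞 → toCyclic B ∈ 𝒞 →
    (toCyclic A ≠ toCyclic B ∨ ∃ v : ZMod r₁ × ZMod r₂, v ≠ 0 ∧ B = shift v A) →
      toCyclic (A + B) ∈ 𝒞

/-! ### Folding -/

/-- Folding the first `r₁ r₂` entries of `a` into an `r₁ × r₂` array: the entry at `(i, j)` is
`a_k`, where `0 ≤ k < r₁ r₂`, `k ≡ i (mod r₁)` and `k ≡ j (mod r₂)`. -/
def fold {r₁ r₂ : ℕ} (h : Nat.Coprime r₁ r₂) (a : ℕ → ZMod 2) : TorusArray r₁ r₂ :=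
  fun i j => a (Nat.chineseRemainder h i.val j.val)

/-- The array code obtained by folding the nonzero sequences generated by `g`. -/
def foldedCode {r₁ r₂ : ℕ} (h : Nat.Coprime r₁ r₂) (g : (ZMod 2)[X]) :
    Set (CyclicArray r₁ r₂) :=
  {c | ∃ a : ℕ → ZMod 2, Generates g a ∧ a ≠ 0 ∧ c = toCyclic (fold h a)}

end

end ArrayCode

namespace ArrayCode

variable {ι K : Type*} [Field K]

/-! ### Power sums at distinct nodes -/

/-! Let `R` be the roots of `f₁` and `T` those of a product of distinct `h i`. Elements of `R` have
order `r₁` and elements of `T` order `r₂`. As `r₁` and `r₂` are coprime, the products `α * β` are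
distinct and all have order `r₁ * r₂` (`injOn_mul`, `orderOf_mul`). The generated sequences are
therefore exactly the binary sequences `a k = ∑ A (α, β) * (α * β)⁻¹ ^ k`
(`generates_iff_exists_sum`), and distinct geometric sequences are independent by Vandermonde. Hence
every nonzero sequence has least period `r₁ * r₂`, and fewer roots give a subcode.

By the Chinese remainder theorem the folded entry at `(s, t)` is `∑ A (α, β) * α⁻¹ ^ s * β⁻¹ ^ t`.
Vandermonde in each variable shows that a zero window of size `R.card × T.card` forces `a = 0`. The
degree equals the number of window entries, so taking the first window is a linear bijection
(`existsUnique_window_eq`). Shifts of the array are time shifts of the sequence, which moves every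
window to the origin; the code axioms follow (`isPRAC`). -/

theorem eq_zero_of_sum_mul_pow_eq_zero {s : Finset ι} {v : ι → K} (hv : Set.InjOn v s)
    {A : ι → K} (h : ∀ k < s.card, ∑ x ∈ s, A x * v x ^ k = 0) : ∀ x ∈ s, A x = 0 := by
  have hinj : Function.Injective fun j => v (s.equivFin.symm j) := fun i j hij =>
    s.equivFin.symm.injective (Subtype.ext (hv (s.equivFin.symm i).2 (s.equivFin.symm j).2 hij))
  have key := Matrix.eq_zero_of_forall_pow_sum_mul_pow_eq_zero (R := K)
    (v := fun j => A (s.equivFin.symm j)) hinj (by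
      intro k
      rw [s.equivFin.symm.sum_comp (fun x : s => A x * v x ^ (k : ℕ)),
        Finset.sum_coe_sort s (fun x => A x * v x ^ (k : ℕ))]
      exact h k k.2)
  intro x hx
  simpa using congrFun key (s.equivFin ⟨x, hx⟩)

/-- The Vandermonde system is square, so its injectivity gives solvability. -/
theorem exists_sum_mul_pow_eq {s : Finset ι} {v : ι → K} (hv : Set.InjOn v s) (y : ℕ → K) :
    ∃ A : ι → K, ∀ k < s.card, ∑ x ∈ s, A x * v x ^ k = y k := by
  classical
  let φ : (s → K) →ₗ[K] (Fin s.card → K) :=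
    { toFun := fun A k => ∑ x : s, A x * v x ^ (k : ℕ)
      map_add' := fun A B => by ext k; simp [add_mul, Finset.sum_add_distrib]
      map_smul' := fun c A => by ext k; simp [Finset.mul_sum, mul_assoc] }
  have extend_apply : ∀ (A : s → K) (k : ℕ),
      ∑ x ∈ s, (if hx : x ∈ s then A ⟨x, hx⟩ else 0) * v x ^ k = ∑ x : s, A x * v x ^ k := by
    intro A k
    rw [← Finset.sum_coe_sort s]
    exact Finset.sum_congr rfl fun x _ => by simp
  have hinj : Function.Injective φ := by
    rw [injective_iff_map_eq_zero]
    intro A hA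
    ext x
    have := eq_zero_of_sum_mul_pow_eq_zero hv
      (A := fun x => if hx : x ∈ s then A ⟨x, hx⟩ else 0)
      (fun k hk => (extend_apply A k).trans (congrFun hA ⟨k, hk⟩)) x x.2
    simpa using this
  have hsurj := (LinearMap.injective_iff_surjective_of_finrank_eq_finrank (f := φ)
    (by simp)).1 hinj
  obtain ⟨A, hA⟩ := hsurj fun k => y k
  exact ⟨fun x => if hx : x ∈ s then A ⟨x, hx⟩ else 0, fun k hk =>
    (extend_apply A k).trans (congrFun hA ⟨k, hk⟩)⟩

/-! ### Linear recurrences -/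

/-- The constant term 1 lets the left side of the recurrence join the sum as its term `i = 0`; a
root of `g` can then be substituted. -/
theorem generates_iff {g : (ZMod 2)[X]} (h0 : g.coeff 0 = 1) {a : ℕ → ZMod 2} :
    Generates g a ↔
      ∀ k, ∑ i ∈ Finset.range (g.natDegree + 1), g.coeff i * a (k + g.natDegree - i) = 0 := by
  have key : ∀ k, (a (k + g.natDegree) = ∑ i ∈ Finset.Icc 1 g.natDegree,
      -g.coeff i * a (k + g.natDegree - i)) ↔
      ∑ i ∈ Finset.range (g.natDegree + 1), g.coeff i * a (k + g.natDegree - i) = 0 := by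
    intro k
    rw [Finset.sum_range_succ', show Finset.Icc 1 g.natDegree = Finset.Ico 1 (g.natDegree + 1) from
      rfl, Finset.sum_Ico_eq_sum_range]
    simp only [h0, one_mul, tsub_zero, neg_mul, Finset.sum_neg_distrib, add_tsub_cancel_right,
      add_comm 1]
    rw [eq_neg_iff_add_eq_zero, add_comm]
  constructor
  · intro h k
    exact (key k).1 (h _ (Nat.le_add_left _ _))
  · intro h k hk
    obtain ⟨m, rfl⟩ := Nat.exists_eq_add_of_le' hk
    exact (key m).2 (h m)

/-- The linear recurrence of Mathlib that `g` defines. -/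
noncomputable def recurrence (g : (ZMod 2)[X]) : LinearRecurrence (ZMod 2) :=
  ⟨g.natDegree, fun i => -g.coeff (g.natDegree - i)⟩

/-- `solSpace` supplies the linear structure and the dimension `g.natDegree`. -/
theorem generates_iff_mem_solSpace {g : (ZMod 2)[X]} {a : ℕ → ZMod 2} :
    Generates g a ↔ a ∈ (recurrence g).solSpace := by
  rw [← LinearRecurrence.is_sol_iff_mem_solSpace]
  have key : ∀ k, ∑ i ∈ Finset.Icc 1 g.natDegree, -g.coeff i * a (k + g.natDegree - i) =
      ∑ i : Fin g.natDegree, -g.coeff (g.natDegree - i) * a (k + i) := by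
    intro k
    rw [Fin.sum_univ_eq_sum_range fun i => -g.coeff (g.natDegree - i) * a (k + i)]
    refine Finset.sum_bij' (fun i _ => g.natDegree - i) (fun i _ => g.natDegree - i) ?_ ?_ ?_ ?_ ?_
    · intro i hi
      simp only [Finset.mem_Icc, Finset.mem_range] at hi ⊢
      omega
    · intro i hi
      simp only [Finset.mem_Icc, Finset.mem_range] at hi ⊢
      omega
    · intro i hi
      simp only [Finset.mem_Icc] at hi
      omega
    · intro i hi
      simp only [Finset.mem_range] at hi
      omega
    · intro i hi
      simp only [Finset.mem_Icc] at hi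
      rw [Nat.sub_sub_self hi.2, Nat.add_sub_assoc hi.2]
  constructor
  · intro h k
    exact (h _ (Nat.le_add_left _ _)).trans (key k)
  · intro h k hk
    obtain ⟨m, rfl⟩ := Nat.exists_eq_add_of_le' hk
    exact (h m).trans (key m).symm

theorem Generates.shift {g : (ZMod 2)[X]} {a : ℕ → ZMod 2} (h : Generates g a) (t : ℕ) :
    Generates g fun k => a (k + t) := by
  intro k hk
  refine (h (k + t) (hk.trans (Nat.le_add_right _ _))).trans (Finset.sum_congr rfl fun i hi => ?_)
  rw [Nat.sub_add_comm ((Finset.mem_Icc.1 hi).2.trans hk)]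

theorem Generates.add {g : (ZMod 2)[X]} {a b : ℕ → ZMod 2} (ha : Generates g a)
    (hb : Generates g b) : Generates g (a + b) := by
  rw [generates_iff_mem_solSpace] at *
  exact add_mem ha hb

variable [Algebra (ZMod 2) K]

/-- The sequences generated by a polynomial with distinct nonzero roots `γ x` are the combinations
of the sequences `k ↦ (γ x)⁻¹ ^ k`. -/
theorem generates_iff_exists_sum {g : (ZMod 2)[X]} {s : Finset ι} {γ : ι → K}
    (hg : g.map (algebraMap (ZMod 2) K) = ∏ x ∈ s, (X - C (γ x))) (hγ : ∀ x ∈ s, γ x ≠ 0)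
    (hinj : Set.InjOn γ s) {a : ℕ → ZMod 2} :
    Generates g a ↔
      ∃ A : ι → K, ∀ k, algebraMap (ZMod 2) K (a k) = ∑ x ∈ s, A x * (γ x)⁻¹ ^ k := by
  have hdeg : g.natDegree = s.card := by
    rw [← natDegree_map (algebraMap (ZMod 2) K), hg, natDegree_prod_of_monic _ _ fun x _ =>
      monic_X_sub_C _]
    simp
  have h0 : g.coeff 0 = 1 := by
    have hne : g.coeff 0 ≠ 0 := by
      intro h
      have h1 : (g.map (algebraMap (ZMod 2) K)).eval 0 = 0 := by
        rw [← coeff_zero_eq_eval_zero, coeff_map, h, map_zero]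
      rw [hg, eval_prod] at h1
      obtain ⟨x, hx, hx0⟩ := Finset.prod_eq_zero_iff.1 h1
      exact hγ x hx (by simpa using hx0)
    revert hne
    generalize g.coeff 0 = c
    revert c
    decide
  have hroot : ∀ x ∈ s, ∑ i ∈ Finset.range (g.natDegree + 1),
      algebraMap (ZMod 2) K (g.coeff i) * γ x ^ i = 0 := by
    intro x hx
    rw [← eval₂_eq_sum_range, ← eval_map, hg, eval_prod]
    exact Finset.prod_eq_zero hx (by simp)
  -- Factoring `(γ x)⁻¹ ^ (k + g.natDegree)` out of the relation for one geometric sequence leaves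
  -- the value of `g` at `γ x`.
  have hsum : ∀ (A : ι → K) (k : ℕ), ∑ i ∈ Finset.range (g.natDegree + 1),
      algebraMap (ZMod 2) K (g.coeff i) * ∑ x ∈ s, A x * (γ x)⁻¹ ^ (k + g.natDegree - i) = 0 := by
    intro A k
    simp only [Finset.mul_sum]
    rw [Finset.sum_comm]
    refine Finset.sum_eq_zero fun x hx => ?_
    have : ∀ i ∈ Finset.range (g.natDegree + 1),
        algebraMap (ZMod 2) K (g.coeff i) * (A x * (γ x)⁻¹ ^ (k + g.natDegree - i)) =
        A x * (γ x)⁻¹ ^ (k + g.natDegree) * (algebraMap (ZMod 2) K (g.coeff i) * γ x ^ i) := by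
      intro i hi
      have hi' : i ≤ k + g.natDegree := by
        rw [Finset.mem_range] at hi
        omega
      have : (γ x)⁻¹ ^ (k + g.natDegree - i) = (γ x)⁻¹ ^ (k + g.natDegree) * γ x ^ i := by
        conv_rhs => rw [← Nat.sub_add_cancel hi', pow_add, mul_assoc, ← mul_pow,
          inv_mul_cancel₀ (hγ x hx), one_pow, mul_one]
      rw [this]
      ring
    rw [Finset.sum_congr rfl this, ← Finset.mul_sum, hroot x hx, mul_zero]
  rw [generates_iff h0]
  constructor
  · intro h
    -- The coefficients are fitted to the first `s.card` terms; the common recurrence propagates the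
    -- equality.
    obtain ⟨A, hA⟩ := exists_sum_mul_pow_eq (v := fun x => (γ x)⁻¹)
      (fun x hx y hy hxy => hinj hx hy (inv_injective hxy))
      (fun k => algebraMap (ZMod 2) K (a k))
    refine ⟨A, fun k => ?_⟩
    induction k using Nat.strong_induction_on with
    | _ k ih =>
      rcases lt_or_ge k s.card with hk | hk
      · exact (hA k hk).symm
      · obtain ⟨m, rfl⟩ := Nat.exists_eq_add_of_le' hk
        have h1 := congrArg (algebraMap (ZMod 2) K) (h m)
        have h2 := hsum A m
        rw [map_sum, map_zero, ← h2, Finset.sum_range_succ', Finset.sum_range_succ' (fun i => _ * _),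
          hdeg] at h1
        simp only [h0, map_mul, map_one, one_mul, tsub_zero] at h1
        refine add_left_cancel (h1.trans (congrArg (· + _) (Finset.sum_congr rfl fun i hi => ?_)))
        rw [Finset.mem_range] at hi
        rw [ih _ (by omega)]
  · rintro ⟨A, hA⟩ k
    apply (algebraMap (ZMod 2) K).injective
    rw [map_sum, map_zero, ← hsum A k]
    simp only [map_mul, hA]

end ArrayCode
namespace ArrayCode

variable {K : Type*} [Field K]

/-! ### Folding and the Chinese remainder theorem -/

theorem exists_natCast_eq {r₁ r₂ : ℕ} [NeZero r₁] [NeZero r₂] (hr : Nat.Coprime r₁ r₂)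
    (v : ZMod r₁ × ZMod r₂) : ∃ t : ℕ, (t : ZMod r₁) = v.1 ∧ (t : ZMod r₂) = v.2 := by
  refine ⟨Nat.chineseRemainder hr v.1.val v.2.val, ?_, ?_⟩
  · rw [(ZMod.natCast_eq_natCast_iff _ _ _).2 (Nat.chineseRemainder hr v.1.val v.2.val).2.1,
      ZMod.natCast_zmod_val]
  · rw [(ZMod.natCast_eq_natCast_iff _ _ _).2 (Nat.chineseRemainder hr v.1.val v.2.val).2.2,
      ZMod.natCast_zmod_val]

/-- Periodicity makes the choice of Chinese remainder representative immaterial. -/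
theorem fold_natCast {r₁ r₂ : ℕ} (hr : Nat.Coprime r₁ r₂) {a : ℕ → ZMod 2}
    (ha : ∀ k k', k ≡ k' [MOD r₁ * r₂] → a k = a k') (k : ℕ) : fold hr a k k = a k := by
  refine ha _ _ ((Nat.modEq_and_modEq_iff_modEq_mul hr).1 ⟨?_, ?_⟩)
  · refine (Nat.chineseRemainder hr _ _).2.1.trans ?_
    rw [ZMod.val_natCast]
    exact Nat.mod_modEq k r₁
  · refine (Nat.chineseRemainder hr _ _).2.2.trans ?_
    rw [ZMod.val_natCast]
    exact Nat.mod_modEq k r₂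

theorem shift_fold {r₁ r₂ : ℕ} [NeZero r₁] [NeZero r₂] (hr : Nat.Coprime r₁ r₂) {a : ℕ → ZMod 2}
    (ha : ∀ k k', k ≡ k' [MOD r₁ * r₂] → a k = a k') (t : ℕ) :
    shift ((t : ZMod r₁), (t : ZMod r₂)) (fold hr a) = fold hr fun k => a (k + t) := by
  ext i j
  obtain ⟨k, hk₁, hk₂⟩ := exists_natCast_eq hr (i, j)
  dsimp only at hk₁ hk₂
  rw [← hk₁, ← hk₂, fold_natCast hr (a := fun k => a (k + t)) fun k k' h => ha _ _ (h.add_right t),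
    shift, ← Nat.cast_add, ← Nat.cast_add, fold_natCast hr ha]

theorem window_zero_shift {r₁ r₂ m₁ m₂ : ℕ} (A : TorusArray r₁ r₂) (v : ZMod r₁ × ZMod r₂) :
    window m₁ m₂ (shift v A) 0 = window m₁ m₂ A v := by
  rw [window_shift, zero_add]

/-! ### Codes from products of roots of coprime orders -/

/-- Over `K`, the polynomial `g` is the product of the `X - α β`, where `α ∈ R` has order `r₁` and
`β ∈ T` has order `r₂`. -/
structure IsProductSplitting (g : (ZMod 2)[X]) [Algebra (ZMod 2) K] (r₁ r₂ : ℕ)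
    (R T : Finset K) : Prop where
  map_eq : g.map (algebraMap (ZMod 2) K) = ∏ x ∈ R ×ˢ T, (X - C (x.1 * x.2))
  orderOf_left : ∀ α ∈ R, orderOf α = r₁
  orderOf_right : ∀ β ∈ T, orderOf β = r₂

theorem ne_zero_of_orderOf_pos {α : K} (h : 0 < orderOf α) : α ≠ 0 := by
  rintro rfl
  rw [orderOf_zero] at h
  exact h.false

/-- If `α * β = α' * β'`, the power `r₂` removes `β` and `β'`, so `α / α'` is killed by the coprime
exponents `r₁` and `r₂`. -/
theorem injOn_mul {r₁ r₂ : ℕ} [NeZero r₁] [NeZero r₂] (hr : Nat.Coprime r₁ r₂)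
    {R T : Finset K} (hR : ∀ α ∈ R, orderOf α = r₁) (hT : ∀ β ∈ T, orderOf β = r₂) :
    Set.InjOn (fun x : K × K => x.1 * x.2) ↑(R ×ˢ T) := by
  rintro ⟨α, β⟩ hx ⟨α', β'⟩ hy hxy
  simp only [Finset.coe_product, Set.mem_prod, Finset.mem_coe] at hx hy hxy
  have hα := hR _ hx.1
  have hα' := hR _ hy.1
  have hβ := hT _ hx.2
  have hβ' := hT _ hy.2
  have hne : α ≠ 0 := ne_zero_of_orderOf_pos (hα ▸ Nat.pos_of_neZero r₁)
  have hne' : α' ≠ 0 := ne_zero_of_orderOf_pos (hα' ▸ Nat.pos_of_neZero r₁)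
  have h1 : (α / α') ^ r₁ = 1 := by
    rw [div_pow, ← hα, pow_orderOf_eq_one, hα, ← hα', pow_orderOf_eq_one, div_one]
  have h2 : (α / α') ^ r₂ = 1 := by
    have := congrArg (· ^ r₂) hxy
    simp only [mul_pow] at this
    rw [← hβ, pow_orderOf_eq_one, hβ, ← hβ', pow_orderOf_eq_one, hβ', mul_one, mul_one] at this
    rw [div_pow, this, div_self (pow_ne_zero _ hne')]
  have h3 : α = α' := by
    have := pow_gcd_eq_one.2 ⟨h1, h2⟩
    rw [hr.gcd_eq_one, pow_one] at this
    exact (div_eq_one_iff_eq hne').1 this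
  subst h3
  rw [mul_left_cancel₀ hne hxy]

/-! ### Periods, shifts and windows of the generated sequences -/

namespace IsProductSplitting

variable [Algebra (ZMod 2) K] {g g' : (ZMod 2)[X]} {r₁ r₂ : ℕ} {R T T' : Finset K}
  {a b : ℕ → ZMod 2}

theorem orderOf_mul (hg : IsProductSplitting g r₁ r₂ R T) (hr : Nat.Coprime r₁ r₂) {x : K × K}
    (hx : x ∈ R ×ˢ T) : orderOf (x.1 * x.2) = r₁ * r₂ := by
  rw [Finset.mem_product] at hx
  rw [(Commute.all _ _).orderOf_mul_eq_mul_orderOf_of_coprime, hg.orderOf_left _ hx.1,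
    hg.orderOf_right _ hx.2]
  rwa [hg.orderOf_left _ hx.1, hg.orderOf_right _ hx.2]

theorem natDegree_eq (hg : IsProductSplitting g r₁ r₂ R T) : g.natDegree = R.card * T.card := by
  rw [← natDegree_map (algebraMap (ZMod 2) K), hg.map_eq, natDegree_prod_of_monic _ _ fun x _ =>
    monic_X_sub_C _]
  simp only [natDegree_X_sub_C, Finset.sum_const, Finset.card_product, smul_eq_mul, mul_one]

variable [NeZero r₁] [NeZero r₂]

theorem mul_ne_zero (hg : IsProductSplitting g r₁ r₂ R T) (hr : Nat.Coprime r₁ r₂) {x : K × K}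
    (hx : x ∈ R ×ˢ T) : x.1 * x.2 ≠ 0 :=
  ne_zero_of_orderOf_pos (hg.orderOf_mul hr hx ▸ Nat.mul_pos (Nat.pos_of_neZero _)
    (Nat.pos_of_neZero _))

theorem injOn_inv_mul (hg : IsProductSplitting g r₁ r₂ R T) (hr : Nat.Coprime r₁ r₂) :
    Set.InjOn (fun x : K × K => (x.1 * x.2)⁻¹) ↑(R ×ˢ T) := fun _ hx _ hy hxy =>
  injOn_mul hr hg.orderOf_left hg.orderOf_right hx hy (inv_injective hxy)

theorem generates_iff (hg : IsProductSplitting g r₁ r₂ R T) (hr : Nat.Coprime r₁ r₂) :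
    Generates g a ↔ ∃ A : K × K → K, ∀ k, algebraMap (ZMod 2) K (a k) =
      ∑ x ∈ R ×ˢ T, A x * (x.1 * x.2)⁻¹ ^ k :=
  generates_iff_exists_sum hg.map_eq (fun _ hx => hg.mul_ne_zero hr hx)
    (injOn_mul hr hg.orderOf_left hg.orderOf_right)

/-- The additional roots receive coefficient zero. -/
theorem generates_mono (hg : IsProductSplitting g r₁ r₂ R T)
    (hg' : IsProductSplitting g' r₁ r₂ R T') (hr : Nat.Coprime r₁ r₂) (hT : T' ⊆ T)
    (ha : Generates g' a) : Generates g a := by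
  classical
  obtain ⟨A, hA⟩ := (hg'.generates_iff hr).1 ha
  refine (hg.generates_iff hr).2 ⟨fun x => if x ∈ R ×ˢ T' then A x else 0, fun k => ?_⟩
  rw [hA, ← Finset.sum_subset (Finset.product_subset_product_right hT)]
  · exact Finset.sum_congr rfl fun x hx => by
      dsimp only
      rw [if_pos hx]
  · intro x _ hx
    dsimp only
    rw [if_neg hx, zero_mul]

theorem congr_of_modEq (hg : IsProductSplitting g r₁ r₂ R T) (hr : Nat.Coprime r₁ r₂)
    (ha : Generates g a) (k k' : ℕ) (h : k ≡ k' [MOD r₁ * r₂]) : a k = a k' := by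
  obtain ⟨A, hA⟩ := (hg.generates_iff hr).1 ha
  apply (algebraMap (ZMod 2) K).injective
  rw [hA, hA]
  refine Finset.sum_congr rfl fun x hx => ?_
  rw [inv_pow, inv_pow, ← pow_mod_orderOf, ← pow_mod_orderOf _ k', hg.orderOf_mul hr hx, h]

/-- A time shift by `p` multiplies the coefficient of a root `γ` by `γ⁻¹ ^ p`, so independence
forces `γ ^ p = 1` wherever the coefficient is nonzero. -/
theorem dvd_of_period (hg : IsProductSplitting g r₁ r₂ R T) (hr : Nat.Coprime r₁ r₂)
    (ha : Generates g a) (h0 : a ≠ 0) {p : ℕ} (hp : ∀ k, a (k + p) = a k) : r₁ * r₂ ∣ p := by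
  obtain ⟨A, hA⟩ := (hg.generates_iff hr).1 ha
  have key := eq_zero_of_sum_mul_pow_eq_zero (hg.injOn_inv_mul hr)
    (A := fun x => A x * ((x.1 * x.2)⁻¹ ^ p - 1)) (by
      intro k _
      have h1 := congrArg (algebraMap (ZMod 2) K) (hp k)
      rw [hA, hA, ← sub_eq_zero, ← Finset.sum_sub_distrib] at h1
      rw [← h1]
      refine Finset.sum_congr rfl fun x _ => ?_
      ring)
  by_contra hdvd
  apply h0
  ext k
  apply (algebraMap (ZMod 2) K).injective
  rw [hA, Pi.zero_apply, map_zero]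
  refine Finset.sum_eq_zero fun x hx => ?_
  rcases mul_eq_zero.1 (key x hx) with h | h
  · rw [h, zero_mul]
  · rw [inv_pow, sub_eq_zero, inv_eq_one] at h
    exact absurd (hg.orderOf_mul hr hx ▸ orderOf_dvd_of_pow_eq_one h) hdvd

theorem hasLeastPeriod (hg : IsProductSplitting g r₁ r₂ R T) (hr : Nat.Coprime r₁ r₂)
    (ha : Generates g a) (h0 : a ≠ 0) : HasLeastPeriod a (r₁ * r₂) :=
  ⟨⟨Nat.mul_pos (Nat.pos_of_neZero _) (Nat.pos_of_neZero _), fun k =>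
    hg.congr_of_modEq hr ha _ _ (by simp [Nat.ModEq])⟩,
    fun _ hp => Nat.le_of_dvd hp.1 (hg.dvd_of_period hr ha h0 hp.2)⟩

theorem fold_injective (hg : IsProductSplitting g r₁ r₂ R T) (hr : Nat.Coprime r₁ r₂)
    (ha : Generates g a) (hb : Generates g b) (h : fold hr a = fold hr b) : a = b := by
  ext k
  rw [← fold_natCast hr (hg.congr_of_modEq hr ha) k, h, fold_natCast hr (hg.congr_of_modEq hr hb) k]

/-- Every shift of a folded sequence is the folding of a shifted sequence. -/
theorem exists_shift_eq (hg : IsProductSplitting g r₁ r₂ R T) (hr : Nat.Coprime r₁ r₂)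
    (ha : Generates g a) (h0 : a ≠ 0) (v : ZMod r₁ × ZMod r₂) :
    ∃ b, Generates g b ∧ b ≠ 0 ∧ shift v (fold hr a) = fold hr b := by
  obtain ⟨t, h₁, h₂⟩ := exists_natCast_eq hr v
  refine ⟨fun k => a (k + t), ha.shift t, fun h => h0 ?_, ?_⟩
  · ext k
    -- The shifted sequence only sees indices from `t` on; adding `t` periods to `k` brings it into
    -- that range.
    have h1 : k + t * (r₁ * r₂) ≡ k [MOD r₁ * r₂] := by simp [Nat.ModEq]
    rw [← hg.congr_of_modEq hr ha _ _ h1]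
    have hpos : 1 ≤ r₁ * r₂ := Nat.mul_pos (Nat.pos_of_neZero _) (Nat.pos_of_neZero _)
    have h2 := congrFun h (k + t * (r₁ * r₂) - t)
    rwa [Nat.sub_add_cancel ((Nat.le_mul_of_pos_right t hpos).trans (Nat.le_add_left _ _))] at h2
  · rw [← shift_fold hr (hg.congr_of_modEq hr ha), h₁, h₂]

theorem eq_zero_of_shift_eq (hg : IsProductSplitting g r₁ r₂ R T) (hr : Nat.Coprime r₁ r₂)
    (ha : Generates g a) (h0 : a ≠ 0) {v : ZMod r₁ × ZMod r₂}
    (hv : shift v (fold hr a) = fold hr a) : v = 0 := by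
  obtain ⟨t, h₁, h₂⟩ := exists_natCast_eq hr v
  have h3 := shift_fold hr (hg.congr_of_modEq hr ha) t
  rw [h₁, h₂, hv] at h3
  have h4 := hg.fold_injective hr ha (ha.shift t) h3
  have h5 := hg.dvd_of_period hr ha h0 (p := t) fun k => (congrFun h4 k).symm
  refine Prod.ext ?_ ?_
  · rw [← h₁]
    exact (ZMod.natCast_eq_zero_iff _ _).2 ((Nat.dvd_mul_right _ _).trans h5)
  · rw [← h₂]
    exact (ZMod.natCast_eq_zero_iff _ _).2 ((Nat.dvd_mul_left _ _).trans h5)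

/-- Foldings are closed under shifts, so membership can be tested on any representative. -/
theorem toCyclic_mem_foldedCode (hg : IsProductSplitting g r₁ r₂ R T) (hr : Nat.Coprime r₁ r₂)
    {A : TorusArray r₁ r₂} :
    toCyclic A ∈ foldedCode hr g ↔ ∃ a, Generates g a ∧ a ≠ 0 ∧ A = fold hr a := by
  constructor
  · rintro ⟨a, ha, h0, h⟩
    obtain ⟨v, rfl⟩ : ∃ v, A = shift v (fold hr a) := Quotient.exact h.symm
    exact hg.exists_shift_eq hr ha h0 v
  · rintro ⟨a, ha, h0, rfl⟩
    exact ⟨a, ha, h0, rfl⟩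

/-- A generated sequence whose folding starts with the zero window is zero. -/
theorem eq_zero_of_window_eq_zero (hg : IsProductSplitting g r₁ r₂ R T) (hr : Nat.Coprime r₁ r₂)
    (ha : Generates g a) (hw : window R.card T.card (fold hr a) 0 = 0) : a = 0 := by
  obtain ⟨A, hA⟩ := (hg.generates_iff hr).1 ha
  -- With `k ≡ s` modulo `r₁` and `k ≡ t` modulo `r₂`, the orders of `α` and `β` separate `(α * β)⁻¹
  -- ^ k` into `α⁻¹ ^ s * β⁻¹ ^ t`.
  have key : ∀ s < R.card, ∀ t < T.card,
      ∑ α ∈ R, (∑ β ∈ T, A (α, β) * β⁻¹ ^ t) * α⁻¹ ^ s = 0 := by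
    intro s hs t ht
    have h1 := congrFun (congrFun hw ⟨s, hs⟩) ⟨t, ht⟩
    simp only [window, Prod.fst_zero, Prod.snd_zero, zero_add, Matrix.zero_apply] at h1
    obtain ⟨k, hk₁, hk₂⟩ := exists_natCast_eq hr ((s : ZMod r₁), (t : ZMod r₂))
    dsimp only at hk₁ hk₂
    rw [← hk₁, ← hk₂, fold_natCast hr (hg.congr_of_modEq hr ha)] at h1
    have h2 := hA k
    rw [h1, map_zero, Finset.sum_product] at h2
    rw [h2]
    refine Finset.sum_congr rfl fun α hα => ?_
    rw [Finset.sum_mul]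
    refine Finset.sum_congr rfl fun β hβ => ?_
    have hα' : α ^ k = α ^ s := by
      rw [← pow_mod_orderOf, ← pow_mod_orderOf _ s, hg.orderOf_left _ hα,
        (ZMod.natCast_eq_natCast_iff' _ _ _).1 hk₁]
    have hβ' : β ^ k = β ^ t := by
      rw [← pow_mod_orderOf, ← pow_mod_orderOf _ t, hg.orderOf_right _ hβ,
        (ZMod.natCast_eq_natCast_iff' _ _ _).1 hk₂]
    rw [inv_pow, inv_pow, inv_pow, mul_pow, hα', hβ', mul_inv]
    ring
  -- Vandermonde in `α` for each fixed `t`, then in `β`.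
  have key₂ : ∀ α ∈ R, ∀ β ∈ T, A (α, β) = 0 := by
    intro α hα
    refine eq_zero_of_sum_mul_pow_eq_zero (v := fun β => β⁻¹) inv_injective.injOn fun t ht => ?_
    exact eq_zero_of_sum_mul_pow_eq_zero (v := fun α => α⁻¹) inv_injective.injOn
      (A := fun α => ∑ β ∈ T, A (α, β) * β⁻¹ ^ t) (fun s hs => key s hs t ht) α hα
  ext k
  apply (algebraMap (ZMod 2) K).injective
  rw [hA, Pi.zero_apply, map_zero]
  refine Finset.sum_eq_zero fun x hx => ?_
  rw [Finset.mem_product] at hx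
  rw [key₂ x.1 hx.1 x.2 hx.2, zero_mul]

/-- Every matrix is the first window of the folding of exactly one generated sequence. -/
theorem existsUnique_window_eq (hg : IsProductSplitting g r₁ r₂ R T) (hr : Nat.Coprime r₁ r₂)
    (M : Matrix (Fin R.card) (Fin T.card) (ZMod 2)) :
    ∃! a, Generates g a ∧ window R.card T.card (fold hr a) 0 = M := by
  let φ : (recurrence g).solSpace →ₗ[ZMod 2] Matrix (Fin R.card) (Fin T.card) (ZMod 2) :=
    { toFun := fun a => window R.card T.card (fold hr a.1) 0
      map_add' := fun a b => rfl
      map_smul' := fun c a => rfl }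
  have hinj : Function.Injective φ := by
    rw [injective_iff_map_eq_zero]
    rintro ⟨a, ha⟩ h
    exact Subtype.ext (hg.eq_zero_of_window_eq_zero hr (generates_iff_mem_solSpace.2 ha) h)
  have : Module.Finite (ZMod 2) (recurrence g).solSpace :=
    Module.Finite.equiv (recurrence g).toInit.symm
  have hsurj := (LinearMap.injective_iff_surjective_of_finrank_eq_finrank (f := φ) (by
    rw [(recurrence g).toInit.finrank_eq, Module.finrank_matrix, Module.finrank_fin_fun,
      Fintype.card_fin, Fintype.card_fin, Module.finrank_self, mul_one]
    exact hg.natDegree_eq)).1 hinj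
  obtain ⟨⟨a, ha⟩, h⟩ := hsurj M
  refine ⟨a, ⟨generates_iff_mem_solSpace.2 ha, h⟩, ?_⟩
  rintro b ⟨hb, hbM⟩
  exact congrArg Subtype.val (hinj (a₁ := ⟨b, generates_iff_mem_solSpace.1 hb⟩) (a₂ := ⟨a, ha⟩)
    (hbM.trans h.symm))

theorem isPRAC (hg : IsProductSplitting g r₁ r₂ R T) (hr : Nat.Coprime r₁ r₂)
    (hdvd : r₁ * r₂ ∣ 2 ^ (R.card * T.card) - 1) :
    IsPRAC R.card T.card (foldedCode hr g) where
  dvd := hdvd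
  window_once := by
    intro M hM
    obtain ⟨a, ⟨ha, haM⟩, huniq⟩ := hg.existsUnique_window_eq hr M
    have h0 : a ≠ 0 := by
      rintro rfl
      exact hM haM.symm
    -- Shifting by `p` makes `M` the first window, and uniqueness identifies the shifted array. This
    -- bounds both the codeword and the position.
    have hpos : ∀ b, Generates g b → b ≠ 0 → ∀ p, window R.card T.card (fold hr b) p = M →
        shift p (fold hr b) = fold hr a := by
      intro b hb hb0 p hp
      obtain ⟨b', hb', _, h⟩ := hg.exists_shift_eq hr hb hb0 p
      rw [h, huniq b' ⟨hb', by rw [← h, window_zero_shift, hp]⟩]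
    refine ⟨toCyclic (fold hr a), ⟨a, ha, h0, rfl⟩, ?_, ?_⟩
    · change Set.encard {p | window R.card T.card (fold hr a) p = M} = 1
      rw [Set.encard_eq_one]
      refine ⟨0, Set.eq_singleton_iff_unique_mem.2 ⟨haM, fun p hp => ?_⟩⟩
      exact hg.eq_zero_of_shift_eq hr ha h0 (hpos a ha h0 p hp)
    · rintro _ ⟨b, hb, hb0, rfl⟩ hne
      change Set.encard {p | window R.card T.card (fold hr b) p = M} = 0
      rw [Set.encard_eq_zero, Set.eq_empty_iff_forall_notMem]
      intro p hp
      exact hne (Quotient.sound ⟨p, (hpos b hb hb0 p hp).symm⟩)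
  window_zero := by
    rintro _ ⟨b, hb, hb0, rfl⟩
    change Set.encard {p | window R.card T.card (fold hr b) p = 0} = 0
    rw [Set.encard_eq_zero, Set.eq_empty_iff_forall_notMem]
    intro p hp
    obtain ⟨b', hb', hb0', h⟩ := hg.exists_shift_eq hr hb hb0 p
    refine hb0' (hg.eq_zero_of_window_eq_zero hr hb' ?_)
    rw [← h, window_zero_shift, hp]
  shift_and_add := by
    intro A B hA hB hAB
    obtain ⟨a, ha, ha0, rfl⟩ := (hg.toCyclic_mem_foldedCode hr).1 hA
    obtain ⟨b, hb, hb0, rfl⟩ := (hg.toCyclic_mem_foldedCode hr).1 hB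
    -- In characteristic 2, `a + b = 0` means `b = a`: neither distinct codewords nor a nontrivial
    -- shift.
    refine (hg.toCyclic_mem_foldedCode hr).2 ⟨a + b, ha.add hb, fun hab => ?_, rfl⟩
    have hba : b = a := by
      ext k
      have h1 := congrFun hab k
      rw [Pi.add_apply, Pi.zero_apply] at h1
      exact (CharTwo.add_eq_zero.1 h1).symm
    subst hba
    rcases hAB with h | ⟨v, hv, h⟩
    · exact h rfl
    · exact hv (hg.eq_zero_of_shift_eq hr ha ha0 h.symm)

end IsProductSplitting

end ArrayCode
namespace ArrayCode

/-! ### Roots of irreducible polynomials -/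

/-- Irreducibility makes `α ^ e = 1` equivalent to `f ∣ X ^ e - 1`. -/
theorem HasExponent.orderOf_root {K : Type*} [Field K] [Algebra (ZMod 2) K] {f : (ZMod 2)[X]}
    (hf : Irreducible f) {r : ℕ} (hr : HasExponent f r) {α : K} (hα : aeval α f = 0) :
    orderOf α = r := by
  have pow_eq_one_iff : ∀ e : ℕ, α ^ e = 1 ↔ f ∣ X ^ e - 1 := by
    intro e
    rw [← hf.dvd_iff_aeval_eq_zero hα]
    simp [sub_eq_zero]
  have hpos : 0 < orderOf α :=
    (isOfFinOrder_iff_pow_eq_one.2 ⟨r, hr.1.1, (pow_eq_one_iff r).2 hr.1.2⟩).orderOf_pos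
  have hle : r ≤ orderOf α := hr.2 ⟨hpos, (pow_eq_one_iff _).1 (pow_orderOf_eq_one α)⟩
  have hdvd := orderOf_dvd_of_pow_eq_one ((pow_eq_one_iff r).2 hr.1.2)
  exact le_antisymm (Nat.le_of_dvd hr.1.1 hdvd) hle

/-- A root satisfies `α ^ 2 ^ f.natDegree = α` and has order `r`. -/
theorem HasExponent.dvd_two_pow_sub_one {f : (ZMod 2)[X]} (hf : Irreducible f) {r : ℕ}
    (hr : HasExponent f r) : r ∣ 2 ^ f.natDegree - 1 := by
  have : Fact (Irreducible f) := ⟨hf⟩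
  have hα : aeval (AdjoinRoot.root f) f = 0 := by
    rw [AdjoinRoot.aeval_eq, AdjoinRoot.mk_self]
  have hord := hr.orderOf_root hf hα
  have h1 : f ∣ X ^ 2 ^ f.natDegree - X := by
    have := hf.natDegree_dvd_iff_dvd_X_pow_card_pow_sub_X.1 (dvd_refl f.natDegree)
    rwa [Nat.card_zmod] at this
  rw [← hf.dvd_iff_aeval_eq_zero hα, map_sub, map_pow, aeval_X, sub_eq_zero] at h1
  rw [← hord]
  refine orderOf_dvd_of_pow_eq_one (mul_right_cancel₀
    (ne_zero_of_orderOf_pos (hord ▸ hr.1.1)) ?_)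
  rw [← pow_succ, Nat.sub_add_cancel Nat.one_le_two_pow, h1, one_mul]

theorem isCoprime_of_irreducible_of_ne {f g : (ZMod 2)[X]} (hf : Irreducible f)
    (hg : Irreducible g) (hne : f ≠ g) : IsCoprime f g := by
  -- The only nonzero scalar is 1, so associated polynomials are equal.
  have monic : ∀ p : (ZMod 2)[X], p ≠ 0 → p.Monic := by
    intro p hp
    have hne := leadingCoeff_ne_zero.2 hp
    rw [Monic]
    revert hne
    generalize p.leadingCoeff = c
    revert c
    decide
  refine hf.coprime_iff_not_dvd.2 fun hdvd => hne ?_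
  exact eq_of_monic_of_associated (monic f hf.ne_zero) (monic g hg.ne_zero)
    (hf.associated_of_dvd hg hdvd)

/-- The set of roots of a separable binary polynomial in the algebraic closure. -/
noncomputable def rootFinset (f : (ZMod 2)[X]) (hf : f.Separable) :
    Finset (AlgebraicClosure (ZMod 2)) :=
  ⟨f.aroots (AlgebraicClosure (ZMod 2)), nodup_roots hf.map⟩

theorem mem_rootFinset {f : (ZMod 2)[X]} {hf : f.Separable} {α : AlgebraicClosure (ZMod 2)} :
    α ∈ rootFinset f hf ↔ aeval α f = 0 :=
  mem_aroots.trans (and_iff_right hf.ne_zero)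

theorem card_rootFinset {f : (ZMod 2)[X]} (hf : f.Separable) :
    (rootFinset f hf).card = f.natDegree := by
  change Multiset.card (f.aroots _) = _
  rw [aroots, ← (IsAlgClosed.splits _).natDegree_eq_card_roots, natDegree_map]

theorem isProductSplitting_vee {f g : (ZMod 2)[X]} (hf : f.Separable) (hg : g.Separable)
    {r₁ r₂ : ℕ} (h₁ : ∀ α ∈ rootFinset f hf, orderOf α = r₁)
    (h₂ : ∀ β ∈ rootFinset g hg, orderOf β = r₂) :
    IsProductSplitting (vee f g) r₁ r₂ (rootFinset f hf) (rootFinset g hg) := by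
  refine ⟨?_, h₁, h₂⟩
  rw [map_vee, Finset.prod_product]
  rfl

/-! ### Products of distinct irreducible polynomials of equal exponent -/

section Products

variable {κ : Type*} {s t : Finset κ} {f : (ZMod 2)[X]} {h : κ → (ZMod 2)[X]} {r₁ r₂ n : ℕ}

theorem separable_prod_of_injOn (hinj : Set.InjOn h s) (hirr : ∀ i ∈ s, Irreducible (h i)) :
    (∏ i ∈ s, h i).Separable :=
  separable_prod' (fun i hi j hj hij => isCoprime_of_irreducible_of_ne (hirr i hi) (hirr j hj)
    fun he => hij (hinj hi hj he)) fun i hi => PerfectField.separable_of_irreducible (hirr i hi)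

theorem isProductSplitting_vee_prod (hf : Irreducible f) (hf_exp : HasExponent f r₁)
    (hinj : Set.InjOn h s) (hirr : ∀ i ∈ s, Irreducible (h i))
    (hexp : ∀ i ∈ s, HasExponent (h i) r₂) :
    IsProductSplitting (vee f (∏ i ∈ s, h i)) r₁ r₂
      (rootFinset f (PerfectField.separable_of_irreducible hf))
      (rootFinset _ (separable_prod_of_injOn hinj hirr)) := by
  refine isProductSplitting_vee _ _ (fun α hα => hf_exp.orderOf_root hf (mem_rootFinset.1 hα))
    fun β hβ => ?_
  rw [mem_rootFinset, map_prod] at hβ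
  obtain ⟨i, hi, hβi⟩ := Finset.prod_eq_zero_iff.1 hβ
  exact (hexp i hi).orderOf_root (hirr i hi) hβi

theorem hasLeastPeriod_of_generates_vee_prod (hr : Nat.Coprime r₁ r₂) (hr₂ : r₂ ≠ 0)
    (hf : Irreducible f) (hf_exp : HasExponent f r₁)
    (hinj : Set.InjOn h s) (hirr : ∀ i ∈ s, Irreducible (h i))
    (hexp : ∀ i ∈ s, HasExponent (h i) r₂) {a : ℕ → ZMod 2} (h0 : a ≠ 0)
    (ha : Generates (vee f (∏ i ∈ s, h i)) a) : HasLeastPeriod a (r₁ * r₂) := by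
  have : NeZero r₁ := ⟨hf_exp.1.1.ne'⟩
  have : NeZero r₂ := ⟨hr₂⟩
  exact (isProductSplitting_vee_prod hf hf_exp hinj hirr hexp).hasLeastPeriod hr ha h0

theorem isPRAC_foldedCode_vee_prod (hr : Nat.Coprime r₁ r₂) (hs : s.Nonempty)
    (hf : Irreducible f) (hf_exp : HasExponent f r₁)
    (hinj : Set.InjOn h s) (hirr : ∀ i ∈ s, Irreducible (h i))
    (hexp : ∀ i ∈ s, HasExponent (h i) r₂) (hdeg : ∀ i ∈ s, (h i).natDegree = n) :
    IsPRAC f.natDegree (s.card * n) (foldedCode hr (vee f (∏ i ∈ s, h i))) := by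
  obtain ⟨i, hi⟩ := hs
  have : NeZero r₁ := ⟨hf_exp.1.1.ne'⟩
  have : NeZero r₂ := ⟨(hexp i hi).1.1.ne'⟩
  have hcard : (∏ i ∈ s, h i).natDegree = s.card * n := by
    rw [natDegree_prod _ _ fun i hi => (hirr i hi).ne_zero, Finset.sum_congr rfl hdeg,
      Finset.sum_const, smul_eq_mul]
  have key := (isProductSplitting_vee_prod hf hf_exp hinj hirr hexp).isPRAC hr
  rw [card_rootFinset, card_rootFinset, hcard] at key
  -- Both degrees divide the exponent of 2, so `r₁` and `r₂` divide separately.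
  refine key (hr.mul_dvd_of_dvd_of_dvd ?_ ?_)
  · exact (hf_exp.dvd_two_pow_sub_one hf).trans
      (Nat.pow_sub_one_dvd_pow_sub_one 2 (Nat.dvd_mul_right _ _))
  · refine ((hexp i hi).dvd_two_pow_sub_one (hirr i hi)).trans
      (Nat.pow_sub_one_dvd_pow_sub_one 2 ?_)
    rw [hdeg i hi]
    exact (Nat.dvd_mul_left _ _).trans (Nat.dvd_mul_left _ _)

theorem foldedCode_vee_prod_mono (hr : Nat.Coprime r₁ r₂) (hr₂ : r₂ ≠ 0) (hts : t ⊆ s)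
    (hf : Irreducible f) (hf_exp : HasExponent f r₁)
    (hinj : Set.InjOn h s) (hirr : ∀ i ∈ s, Irreducible (h i))
    (hexp : ∀ i ∈ s, HasExponent (h i) r₂) :
    foldedCode hr (vee f (∏ i ∈ t, h i)) ⊆ foldedCode hr (vee f (∏ i ∈ s, h i)) := by
  have : NeZero r₁ := ⟨hf_exp.1.1.ne'⟩
  have : NeZero r₂ := ⟨hr₂⟩
  rintro _ ⟨a, ha, h0, rfl⟩
  refine ⟨a, ?_, h0, rfl⟩
  refine (isProductSplitting_vee_prod hf hf_exp hinj hirr hexp).generates_mono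
    (isProductSplitting_vee_prod hf hf_exp (hinj.mono hts) (fun i hi => hirr i (hts hi))
      fun i hi => hexp i (hts hi)) hr (fun β hβ => ?_) ha
  rw [mem_rootFinset] at hβ ⊢
  exact aeval_eq_zero_of_dvd_aeval_eq_zero (Finset.prod_dvd_prod_of_subset _ _ _ hts) hβ

end Products

end ArrayCode

theorem mainTheorem11 (r₁ r₂ n₁ n₂ l : ℕ) (hr : Nat.Coprime r₁ r₂) (hl : 2 ≤ l)
    (f₁ : (ZMod 2)[X]) (hf_irr : Irreducible f₁) (hf_deg : f₁.natDegree = n₁)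
    (hf_exp : ArrayCode.HasExponent f₁ r₁)
    (h : ℕ → (ZMod 2)[X]) (hh_inj : Set.InjOn h (Set.Icc 1 l))
    (hh_irr : ∀ i ∈ Set.Icc 1 l, Irreducible (h i))
    (hh_deg : ∀ i ∈ Set.Icc 1 l, (h i).natDegree = n₂)
    (hh_exp : ∀ i ∈ Set.Icc 1 l, ArrayCode.HasExponent (h i) r₂) :
    (∀ a : ℕ → ZMod 2, a ≠ 0 →
      ArrayCode.Generates (ArrayCode.vee f₁ (∏ i ∈ Finset.Icc 1 l, h i)) a →
        ArrayCode.HasLeastPeriod a (r₁ * r₂)) ∧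
    (∀ a : ℕ → ZMod 2, a ≠ 0 →
      ArrayCode.Generates (ArrayCode.vee f₁ (∏ i ∈ Finset.Icc 1 (l - 1), h i)) a →
        ArrayCode.HasLeastPeriod a (r₁ * r₂)) ∧
    ArrayCode.IsPRAC n₁ (l * n₂)
      (ArrayCode.foldedCode hr (ArrayCode.vee f₁ (∏ i ∈ Finset.Icc 1 l, h i))) ∧
    ArrayCode.IsPRAC n₁ ((l - 1) * n₂)
      (ArrayCode.foldedCode hr (ArrayCode.vee f₁ (∏ i ∈ Finset.Icc 1 (l - 1), h i))) ∧
    ArrayCode.foldedCode hr (ArrayCode.vee f₁ (∏ i ∈ Finset.Icc 1 (l - 1), h i)) ⊆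
      ArrayCode.foldedCode hr (ArrayCode.vee f₁ (∏ i ∈ Finset.Icc 1 l, h i)) := by
  subst hf_deg
  have hr₂ : r₂ ≠ 0 := (hh_exp 1 ⟨le_rfl, by omega⟩).1.1.ne'
  have mem : ∀ i ∈ Finset.Icc 1 l, i ∈ Set.Icc 1 l := fun i hi => Finset.mem_Icc.1 hi
  have hsub : Finset.Icc 1 (l - 1) ⊆ Finset.Icc 1 l :=
    Finset.Icc_subset_Icc_right (Nat.sub_le l 1)
  have hinj : Set.InjOn h ↑(Finset.Icc 1 l) := by rwa [Finset.coe_Icc]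
  have hirr := fun i hi => hh_irr i (mem i hi)
  have hexp := fun i hi => hh_exp i (mem i hi)
  have hdeg := fun i hi => hh_deg i (mem i hi)
  have hinj' := hinj.mono hsub
  have hirr' := fun i hi => hirr i (hsub hi)
  have hexp' := fun i hi => hexp i (hsub hi)
  have hdeg' := fun i hi => hdeg i (hsub hi)
  refine ⟨fun a h0 ha => ?_, fun a h0 ha => ?_, ?_, ?_, ?_⟩
  · exact ArrayCode.hasLeastPeriod_of_generates_vee_prod hr hr₂ hf_irr hf_exp hinj hirr hexp h0 ha
  · exact ArrayCode.hasLeastPeriod_of_generates_vee_prod hr hr₂ hf_irr hf_exp hinj' hirr' hexp'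
      h0 ha
  · have := ArrayCode.isPRAC_foldedCode_vee_prod hr (Finset.nonempty_Icc.2 (by omega)) hf_irr
      hf_exp hinj hirr hexp hdeg
    rwa [Nat.card_Icc, Nat.add_sub_cancel] at this
  -- Here `2 ≤ l` keeps the index range nonempty.
  · have := ArrayCode.isPRAC_foldedCode_vee_prod hr (Finset.nonempty_Icc.2 (by omega)) hf_irr
      hf_exp hinj' hirr' hexp' hdeg'
    rwa [Nat.card_Icc, Nat.add_sub_cancel] at this
  · exact ArrayCode.foldedCode_vee_prod_mono hr hr₂ hsub hf_irr hf_exp hinj hirr hexp
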